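/- For integers $\xi\neq 0$ and $\eta$ let $\omega(\xi,\eta)=\xi^3-\eta^2/\xi$. Equip $\mathbb{R}\times\mathbb{Z}^2$, with points $(\tau,\xi,\eta)$, with the product of Lebesgue measure and counting measures, and let $f_1*f_2$ denote convolution on this group. For every $c\ge 1$ there are constants $K,C>0$ depending only on $c$ such that the following holds. Let $\alpha\le 1$ and $D^*\ge 2$ be real, let $N_1,N_2,L_1,L_2\in 2^{\mathbb{N}_0}$ be dyadic numbers, put $L_{\max}=\max(L_1,L_2)$, and suppose that $$K N_2\le N_1,\qquad N_1^{\alpha}\le L_{\max}\le c\,N_1^2N_2 .$$ Let $f_1,f_2:\mathbb{R}\times\mathbb{Z}\times\mathbb{Z}\to\mathbb{C}$ be in $L^2(\mathbb{R}\times\mathbb{Z}^2)$ and such that for all $(\tau_i,\xi_i,\eta_i)\in\operatorname{supp}(f_i)$, $i=1,2$, $$c^{-1}N_i\le|\xi_i|\le c\,N_i,\qquad |\tau_i-\omega(\xi_i,\eta_i)|\le c\,L_i,\qquad \Big|\frac{\eta_1}{\xi_1}-\frac{\eta_2}{\xi_2}\Big|\le c\,D^* .$$ Then the integral defining $f_1*f_2$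 converges absolutely at every point, $f_1*f_2\in L^2(\mathbb{R}\times\mathbb{Z}^2)$, and $$\|f_1*f_2\|_{L^2(\mathbb{R}\times\mathbb{Z}^2)}\le C\,\log(D^*)\,\big(N_2^{1/2}N_1^{-\alpha/2}+N_2^{1/4}N_1^{-\alpha/4}\big)\prod_{i=1}^2L_i^{1/2}\|f_i\|_{L^2(\mathbb{R}\times\mathbb{Z}^2)} .$$ -/

import Mathlib

noncomputable section

namespace KPII

/-- Frequency space `ℝ × ℤ × ℤ` with points `(τ, ξ, η)`. -/
abbrev Freq : Type := ℝ × ℤ × ℤ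

/-- Lebesgue measure in `τ` times counting measure in `ξ` and in `η`. -/
def freqMeasure : MeasureTheory.Measure Freq :=
  (MeasureTheory.volume : MeasureTheory.Measure ℝ).prod
    ((MeasureTheory.Measure.count : MeasureTheory.Measure ℤ).prod
      (MeasureTheory.Measure.count : MeasureTheory.Measure ℤ))

/-- The dispersion relation `ω(ξ, η) = ξ³ - η² / ξ`, only used for `ξ ≠ 0`. -/
def omega (ξ η : ℤ) : ℝ := (ξ : ℝ) ^ 3 - (η : ℝ) ^ 2 / (ξ : ℝ)

/-- Dyadic numbers: the elements of `2^{ℕ₀}`. -/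
def IsDyadic (x : ℝ) : Prop := ∃ k : ℕ, x = 2 ^ k

/-- On the support of `f` one has `|ξ| ∼ N` and `|τ - ω(ξ, η)| ≲ L`, both with implicit
constant `c`. -/
def LocalizedAt (c N L : ℝ) (f : Freq → ℂ) : Prop :=
  ∀ τ : ℝ, ∀ ξ η : ℤ, (τ, ξ, η) ∈ Function.support f →
    (N / c ≤ |(ξ : ℝ)| ∧ |(ξ : ℝ)| ≤ c * N) ∧ |τ - omega ξ η| ≤ c * L

/-- `|η₁ / ξ₁ - η₂ / ξ₂| ≲ D` with implicit constant `c`, for all pairs of points of the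
supports. -/
def TransversalityLE (c D : ℝ) (f₁ f₂ : Freq → ℂ) : Prop :=
  ∀ τ₁ τ₂ : ℝ, ∀ ξ₁ η₁ ξ₂ η₂ : ℤ,
    (τ₁, ξ₁, η₁) ∈ Function.support f₁ → (τ₂, ξ₂, η₂) ∈ Function.support f₂ →
      |(η₁ : ℝ) / (ξ₁ : ℝ) - (η₂ : ℝ) / (ξ₂ : ℝ)| ≤ c * D

end KPII

end

/-!
By Cauchy–Schwarz, the `L²` norm of `f₁ ∗ f₂` is controlled by the largest measure of the set of
points `z ∈ supp f₁` with `x - z ∈ supp f₂`. In `τ` such a set has length `≲ min L₁ L₂`, so it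
remains to count the spatial frequencies `(ξ₁, η₁)`. They satisfy
`|τ - ω(ξ₁, η₁) - ω(ξ - ξ₁, η - η₁)| ≲ max L₁ L₂`, and the left-hand side is a multiple of
`t² - A(ξ₁)`, where `t = η₁ / ξ₁ - η₂ / ξ₂` is affine in `η₁`. Hence for fixed `ξ₁` the number of
`η₁` is `≲ 1 + √(N₂ max L₁ L₂)`, and also `≲ 1 + max L₁ L₂ / √|A(ξ₁)|`. If `ξ₁ = p` minimises
`|A|`, then `|A(q)| ≳ N₁² |q - p| / N₂` for all other `q`, so the fibres add up to a sum of `1 / √k`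
over `1 ≤ k ≲ N₂`, which costs only `√N₂`.
-/

open MeasureTheory Measure Function Set
open scoped ENNReal Convolution

namespace KPII

section Convolution

lemma eLpNorm_le_eLpNorm_mul_rpow_measure_support {α E : Type*} [MeasurableSpace α]
    {μ : Measure α} [NormedAddCommGroup E] {f : α → E} {p q : ℝ≥0∞} (hpq : p ≤ q)
    (hf : AEStronglyMeasurable f μ) :
    eLpNorm f p μ ≤ eLpNorm f q μ * μ (support f) ^ (1 / p.toReal - 1 / q.toReal) := by
  have hsupp : support f ⊆ toMeasurable μ (support f) := subset_toMeasurable μ _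
  have h := eLpNorm_le_eLpNorm_mul_rpow_measure_univ hpq
    (hf.restrict (s := toMeasurable μ (support f)))
  rwa [eLpNorm_restrict_eq_of_support_subset hsupp, eLpNorm_restrict_eq_of_support_subset hsupp,
    restrict_apply_univ, measure_toMeasurable] at h

lemma eLpNorm_two_sq {α E : Type*} [MeasurableSpace α] {μ : Measure α} [NormedAddCommGroup E]
    (f : α → E) : eLpNorm f 2 μ ^ 2 = ∫⁻ x, ‖f x‖ₑ ^ 2 ∂μ := by
  simpa using eLpNorm_nnreal_pow_eq_lintegral (f := f) (μ := μ) (two_ne_zero (α := NNReal))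

lemma sq_lintegral_enorm_le {α E : Type*} [MeasurableSpace α] {μ : Measure α}
    [NormedAddCommGroup E] {f : α → E} (hf : AEStronglyMeasurable f μ) :
    (∫⁻ x, ‖f x‖ₑ ∂μ) ^ 2 ≤ μ (support f) * ∫⁻ x, ‖f x‖ₑ ^ 2 ∂μ := by
  have h := pow_le_pow_left' (eLpNorm_le_eLpNorm_mul_rpow_measure_support one_le_two hf) 2
  rw [eLpNorm_one_eq_lintegral_enorm, mul_pow, eLpNorm_two_sq, ← ENNReal.rpow_mul_natCast] at h
  norm_num at h
  rwa [mul_comm]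

lemma lintegral_lconvolution {G : Type*} [AddGroup G] [MeasurableSpace G] [MeasurableAdd₂ G]
    [MeasurableNeg G] {μ : Measure G} [SFinite μ] [μ.IsAddLeftInvariant] {u v : G → ℝ≥0∞}
    (hu : AEMeasurable u μ) (hv : AEMeasurable v μ) :
    ∫⁻ x, lconvolution u v μ x ∂μ = (∫⁻ x, u x ∂μ) * ∫⁻ x, v x ∂μ := by
  have hv_add (y : G) : AEMeasurable (fun x => v (-y + x)) μ :=
    hv.comp_quasiMeasurePreserving (measurePreserving_add_left μ (-y)).quasiMeasurePreserving
  calc ∫⁻ x, ∫⁻ y, u y * v (-y + x) ∂μ ∂μ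
      = ∫⁻ y, ∫⁻ x, u y * v (-y + x) ∂μ ∂μ := lintegral_lintegral_swap (by fun_prop)
    _ = ∫⁻ y, u y * ∫⁻ x, v x ∂μ ∂μ := lintegral_congr fun y => by
        rw [lintegral_const_mul'' _ (hv_add y), lintegral_add_left_eq_self]
    _ = (∫⁻ x, u x ∂μ) * ∫⁻ x, v x ∂μ := lintegral_mul_const'' _ hu

variable {𝕜 G E E' F : Type*} [NontriviallyNormedField 𝕜]
  [NormedAddCommGroup E] [NormedSpace 𝕜 E] [NormedAddCommGroup E'] [NormedSpace 𝕜 E']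
  [NormedAddCommGroup F] [NormedSpace 𝕜 F]
  [MeasurableSpace G] {μ : Measure G} {f : G → E} {g : G → E'} (L : E →L[𝕜] E' →L[𝕜] F)

variable [AddCommGroup G] [MeasurableAdd₂ G] [MeasurableNeg G] [μ.IsAddLeftInvariant]
  [μ.IsNegInvariant]

lemma convolutionExists_of_memLp_two (hf : MemLp f 2 μ) (hg : MemLp g 2 μ) :
    ConvolutionExists f g L μ := fun x =>
  memLp_one_iff_integrable.1
    (L.memLp_of_bilin 1 hf (hg.comp_measurePreserving (measurePreserving_sub_left μ x)))

variable [NormedSpace ℝ F]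

lemma sq_enorm_convolution_le (hf : AEStronglyMeasurable f μ) (hg : AEStronglyMeasurable g μ)
    (x : G) :
    ‖(f ⋆[L, μ] g) x‖ₑ ^ 2 ≤ μ (support f ∩ (x - ·) ⁻¹' support g) *
      (‖L‖ₑ ^ 2 * lconvolution (‖f ·‖ₑ ^ 2) (‖g ·‖ₑ ^ 2) μ x) := by
  have hmeas : AEStronglyMeasurable (fun t => L (f t) (g (x - t))) μ :=
    L.aestronglyMeasurable_comp₂ hf (hg.comp_measurePreserving (measurePreserving_sub_left μ x))
  have hsupp : support (fun t => L (f t) (g (x - t))) ⊆ support f ∩ (x - ·) ⁻¹' support g :=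
    fun t ht => ⟨fun h0 => ht (by simp [h0]), fun h0 => ht (by simp [h0])⟩
  have hL (t : G) : ‖L (f t) (g (x - t))‖ₑ ^ 2 ≤ ‖L‖ₑ ^ 2 * (‖f t‖ₑ ^ 2 * ‖g (-t + x)‖ₑ ^ 2) := by
    rw [← mul_pow, ← mul_pow, ← mul_assoc, ← sub_eq_neg_add]
    exact pow_le_pow_left' (L.le_opENorm₂ _ _) 2
  calc ‖(f ⋆[L, μ] g) x‖ₑ ^ 2
      ≤ (∫⁻ t, ‖L (f t) (g (x - t))‖ₑ ∂μ) ^ 2 :=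
        pow_le_pow_left' (enorm_integral_le_lintegral_enorm _) 2
    _ ≤ μ (support fun t => L (f t) (g (x - t))) * ∫⁻ t, ‖L (f t) (g (x - t))‖ₑ ^ 2 ∂μ :=
        sq_lintegral_enorm_le hmeas
    _ ≤ μ (support f ∩ (x - ·) ⁻¹' support g) *
          ∫⁻ t, ‖L‖ₑ ^ 2 * (‖f t‖ₑ ^ 2 * ‖g (-t + x)‖ₑ ^ 2) ∂μ :=
        mul_le_mul' (measure_mono hsupp) (lintegral_mono hL)
    _ = _ := by rw [lintegral_const_mul' _ _ (by finiteness)]; rfl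

variable [SFinite μ]

lemma eLpNorm_two_convolution_le (hf : AEStronglyMeasurable f μ) (hg : AEStronglyMeasurable g μ)
    {B : ℝ≥0∞} (hB : ∀ x, μ (support f ∩ (x - ·) ⁻¹' support g) ≤ B ^ 2) :
    eLpNorm (f ⋆[L, μ] g) 2 μ ≤ ‖L‖ₑ * B * (eLpNorm f 2 μ * eLpNorm g 2 μ) := by
  refine (ENNReal.pow_le_pow_left_iff two_ne_zero).1 ?_
  have hf2 : AEMeasurable (‖f ·‖ₑ ^ 2) μ := hf.enorm.pow_const 2
  have hg2 : AEMeasurable (‖g ·‖ₑ ^ 2) μ := hg.enorm.pow_const 2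
  calc eLpNorm (f ⋆[L, μ] g) 2 μ ^ 2
      = ∫⁻ x, ‖(f ⋆[L, μ] g) x‖ₑ ^ 2 ∂μ := eLpNorm_two_sq _
    _ ≤ ∫⁻ x, B ^ 2 * ‖L‖ₑ ^ 2 * lconvolution (‖f ·‖ₑ ^ 2) (‖g ·‖ₑ ^ 2) μ x ∂μ :=
        lintegral_mono fun x => by
          grw [sq_enorm_convolution_le L hf hg x, hB x, mul_assoc]
    _ = B ^ 2 * ‖L‖ₑ ^ 2 * (eLpNorm f 2 μ ^ 2 * eLpNorm g 2 μ ^ 2) := by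
        rw [lintegral_const_mul'' _ (aemeasurable_lconvolution hf2 hg2),
          lintegral_lconvolution hf2 hg2, eLpNorm_two_sq, eLpNorm_two_sq]
    _ = (‖L‖ₑ * B * (eLpNorm f 2 μ * eLpNorm g 2 μ)) ^ 2 := by ring

lemma memLp_two_convolution (hf : MemLp f 2 μ) (hg : MemLp g 2 μ) {B : ℝ≥0∞} (hB_top : B ≠ ∞)
    (hB : ∀ x, μ (support f ∩ (x - ·) ⁻¹' support g) ≤ B ^ 2) : MemLp (f ⋆[L, μ] g) 2 μ := by
  refine ⟨(hf.1.convolution_integrand L hg.1).integral_prod_right', ?_⟩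
  exact (eLpNorm_two_convolution_le L hf.1 hg.1 hB).trans_lt (by finiteness [hf.2, hg.2])

end Convolution

section ProdCount

variable {α β : Type*} [MeasurableSpace β] [MeasurableSingletonClass β]

lemma prod_count_le_count_image_snd_mul [MeasurableSpace α] [Countable β] {μ : Measure α}
    {E : Set (α × β)} {b : ℝ≥0∞} (hb : ∀ y, μ ((·, y) ⁻¹' E) ≤ b) :
    (μ.prod count) E ≤ count (Prod.snd '' E) * b := by
  have hcover : E ⊆ ⋃ y ∈ Prod.snd '' E, ((·, y) ⁻¹' E) ×ˢ {y} := fun z hz =>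
    mem_biUnion (mem_image_of_mem Prod.snd hz) ⟨hz, rfl⟩
  have hslice (y : β) : (μ.prod count) (((·, y) ⁻¹' E) ×ˢ {y}) ≤ b := by
    grw [prod_prod_le, count_singleton, mul_one, hb y]
  calc (μ.prod count) E
      ≤ ∑' y : Prod.snd '' E, (μ.prod count) (((·, y.1) ⁻¹' E) ×ˢ {y.1}) :=
        (measure_mono hcover).trans (measure_biUnion_le _ (to_countable _) _)
    _ ≤ ∑' _ : Prod.snd '' E, b := ENNReal.tsum_le_tsum fun y => hslice y
    _ = count (Prod.snd '' E) * b := by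
        rw [ENNReal.tsum_set_const, count_apply (to_countable _).measurableSet]

lemma count_le_sum_fibre [MeasurableSpace α] [MeasurableSingletonClass α] {S : Set (α × β)}
    {X : Finset α} (hX : ∀ z ∈ S, z.1 ∈ X) :
    count S ≤ ∑ a ∈ X, count (Prod.mk a ⁻¹' S) := by
  have hcover : S ⊆ ⋃ a ∈ X, Prod.mk a '' (Prod.mk a ⁻¹' S) := fun z hz =>
    mem_biUnion (hX z hz) ⟨z.2, hz, rfl⟩
  calc count S ≤ ∑ a ∈ X, count (Prod.mk a '' (Prod.mk a ⁻¹' S)) :=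
        (measure_mono hcover).trans (measure_biUnion_finset_le X _)
    _ = ∑ a ∈ X, count (Prod.mk a ⁻¹' S) :=
        Finset.sum_congr rfl fun a _ => count_injective_image (Prod.mk_right_injective a) _

end ProdCount

lemma freqMeasure_eq_prod_count :
    freqMeasure = (volume : Measure ℝ).prod (count : Measure (ℤ × ℤ)) := by
  rw [freqMeasure]
  congr 1
  exact Measure.ext_of_singleton fun p => by
    rw [← Prod.mk.eta (p := p), ← singleton_prod_singleton, prod_prod]
    simp

instance : SFinite freqMeasure := by unfold freqMeasure; infer_instance

instance : freqMeasure.IsAddLeftInvariant := by unfold freqMeasure; infer_instance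

instance : freqMeasure.IsNegInvariant where
  neg_eq_self := by
    rw [freqMeasure_eq_prod_count]
    exact ((measurePreserving_neg (volume : Measure ℝ)).prod
      (measurePreserving_neg (count : Measure (ℤ × ℤ)))).map_eq

section IntegerCounting

lemma count_le_of_forall_sub_le {S : Set ℤ} {d : ℝ} (hd : 0 ≤ d)
    (h : ∀ m ∈ S, ∀ n ∈ S, (m : ℝ) - n ≤ d) : count S ≤ ENNReal.ofReal (d + 1) := by
  rcases S.eq_empty_or_nonempty with rfl | ⟨p, hp⟩
  · simp
  have hfloor : ∀ m ∈ S, ∀ n ∈ S, m - n ≤ ⌊d⌋ := fun m hm n hn =>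
    Int.le_floor.2 (by exact_mod_cast h m hm n hn)
  have hbdd : BddBelow S := ⟨p - ⌊d⌋, fun n hn => by linarith [hfloor p hp n hn]⟩
  have hsub : S ⊆ Finset.Icc (sInf S) (sInf S + ⌊d⌋) := fun n hn => by
    simp only [Finset.coe_Icc, mem_Icc]
    exact ⟨csInf_le hbdd hn, by linarith [hfloor n hn _ (Int.csInf_mem ⟨p, hp⟩ hbdd)]⟩
  calc count S ≤ count (Finset.Icc (sInf S) (sInf S + ⌊d⌋) : Set ℤ) := measure_mono hsub
    _ = (⌊d⌋₊ + 1 : ℕ) := by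
        rw [count_apply_finset, Int.card_Icc, ← Int.natCast_floor_eq_floor hd]
        congr 1
        lia
    _ ≤ ENNReal.ofReal (d + 1) := by
        rw [← ENNReal.ofReal_natCast]
        gcongr
        push_cast
        linarith [Nat.floor_le hd]

lemma count_preimage_affine_le {T : Set ℝ} {a b d : ℝ} (ha : a ≠ 0) (hd : 0 ≤ d)
    (h : ∀ x ∈ T, ∀ y ∈ T, |x - y| ≤ d) :
    count {n : ℤ | a * n + b ∈ T} ≤ ENNReal.ofReal (d / |a| + 1) :=
  count_le_of_forall_sub_le (by positivity) fun m hm n hn => by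
    rw [le_div_iff₀' (abs_pos.2 ha)]
    calc |a| * ((m : ℝ) - n) ≤ |a * (m - n)| := by
          rw [abs_mul]; gcongr; exact le_abs_self _
      _ = |a * m + b - (a * n + b)| := by congr 1; ring
      _ ≤ d := h _ hm _ hn

lemma sq_abs_sub_le_of_abs_sq_sub_le {x y A r : ℝ} (hx : 0 ≤ x) (hy : 0 ≤ y)
    (hxA : |x ^ 2 - A| ≤ r) (hyA : |y ^ 2 - A| ≤ r) : |x - y| ^ 2 ≤ 2 * r := by
  rw [abs_le] at hxA hyA
  rw [sq_abs]
  rcases le_total x y with h | h <;> nlinarith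

lemma abs_sub_mul_sqrt_le_of_abs_sq_sub_le {x y A r : ℝ} (hx : 0 ≤ x) (hy : 0 ≤ y)
    (hxA : |x ^ 2 - A| ≤ r) (hyA : |y ^ 2 - A| ≤ r) : |x - y| * √|A| ≤ 2 * r := by
  have hr : 0 ≤ r := (abs_nonneg _).trans hxA
  refine (sq_le_sq₀ (by positivity) (by positivity)).1 ?_
  rw [mul_pow, Real.sq_sqrt (abs_nonneg A)]
  rcases le_or_gt |A| (2 * r) with hA | hA
  · calc |x - y| ^ 2 * |A| ≤ 2 * r * (2 * r) := by
          gcongr; exact sq_abs_sub_le_of_abs_sq_sub_le hx hy hxA hyA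
      _ = (2 * r) ^ 2 := by ring
  · rw [abs_le] at hxA hyA
    have hle : |A| ≤ (x + y) ^ 2 := by
      rcases abs_cases A with ⟨hA', -⟩ | ⟨hA', -⟩ <;> nlinarith [mul_nonneg hx hy]
    have hdiff : |x ^ 2 - y ^ 2| ≤ 2 * r := abs_le.2 ⟨by linarith, by linarith⟩
    calc |x - y| ^ 2 * |A| ≤ |x - y| ^ 2 * (x + y) ^ 2 := by gcongr
      _ = |x ^ 2 - y ^ 2| ^ 2 := by rw [sq_abs, sq_abs]; ring
      _ ≤ (2 * r) ^ 2 := by gcongr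

lemma count_abs_sq_affine_sub_le {a b A r d : ℝ} (ha : a ≠ 0) (hd : 0 ≤ d)
    (h : ∀ x y : ℝ, 0 ≤ x → 0 ≤ y → |x ^ 2 - A| ≤ r → |y ^ 2 - A| ≤ r → |x - y| ≤ d) :
    count {n : ℤ | |(a * n + b) ^ 2 - A| ≤ r} ≤ ENNReal.ofReal (2 * (d / |a| + 1)) := by
  set T : Set ℝ := {x | 0 ≤ x ∧ |x ^ 2 - A| ≤ r}
  have hT : ∀ x ∈ T, ∀ y ∈ T, |x - y| ≤ d := fun x hx y hy => h x y hx.1 hy.1 hx.2 hy.2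
  have hsub : {n : ℤ | |(a * n + b) ^ 2 - A| ≤ r} ⊆
      {n : ℤ | a * n + b ∈ T} ∪ {n : ℤ | -a * n + -b ∈ T} := fun n hn => by
    rcases le_total 0 (a * n + b) with h0 | h0
    · exact Or.inl ⟨h0, hn⟩
    · refine Or.inr ⟨by linarith, ?_⟩
      rwa [neg_mul, ← neg_add, neg_sq]
  calc _ ≤ ENNReal.ofReal (d / |a| + 1) + ENNReal.ofReal (d / |-a| + 1) :=
        (measure_mono hsub).trans <| (measure_union_le _ _).trans <|
          add_le_add (count_preimage_affine_le ha hd hT)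
            (count_preimage_affine_le (neg_ne_zero.2 ha) hd hT)
    _ = _ := by rw [abs_neg, ← ENNReal.ofReal_add (by positivity) (by positivity), two_mul]

lemma count_abs_sq_affine_sub_le_sqrt {a b A r : ℝ} (ha : a ≠ 0) :
    count {n : ℤ | |(a * n + b) ^ 2 - A| ≤ r} ≤ ENNReal.ofReal (2 * (√(2 * r) / |a| + 1)) :=
  count_abs_sq_affine_sub_le ha (Real.sqrt_nonneg _) fun _ _ hx hy hxA hyA =>
    Real.le_sqrt_of_sq_le (sq_abs_sub_le_of_abs_sq_sub_le hx hy hxA hyA)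

lemma count_abs_sq_affine_sub_le_div_sqrt {a b A r : ℝ} (ha : a ≠ 0) (hA : A ≠ 0) (hr : 0 ≤ r) :
    count {n : ℤ | |(a * n + b) ^ 2 - A| ≤ r} ≤
      ENNReal.ofReal (2 * (2 * r / √|A| / |a| + 1)) :=
  count_abs_sq_affine_sub_le ha (by positivity) fun x y hx hy hxA hyA =>
    (le_div_iff₀ (Real.sqrt_pos.2 (abs_pos.2 hA))).2
      (abs_sub_mul_sqrt_le_of_abs_sq_sub_le hx hy hxA hyA)

lemma sum_natAbs_sub_le {g : ℕ → ℝ} (hg : ∀ k, 0 ≤ g k) {X : Finset ℤ} {p : ℤ} {m : ℕ}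
    (hX : ∀ q ∈ X, (q - p).natAbs ∈ Finset.Icc 1 m) :
    ∑ q ∈ X, g (q - p).natAbs ≤ 2 * ∑ k ∈ Finset.Icc 1 m, g k := by
  have hfibre (k : ℕ) : (X.filter fun q => (q - p).natAbs = k).card ≤ 2 := by
    refine (Finset.card_le_card fun q hq => ?_).trans (Finset.card_le_two (a := p + k) (b := p - k))
    rw [Finset.mem_filter] at hq
    simp only [Finset.mem_insert, Finset.mem_singleton]
    lia
  rw [← Finset.sum_fiberwise_of_maps_to hX, Finset.mul_sum]
  refine Finset.sum_le_sum fun k _ => ?_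
  calc ∑ q ∈ X with (q - p).natAbs = k, g (q - p).natAbs
      = (X.filter fun q => (q - p).natAbs = k).card * g k := by
        rw [Finset.sum_congr rfl fun q hq => by rw [(Finset.mem_filter.1 hq).2],
          Finset.sum_const, nsmul_eq_mul]
    _ ≤ 2 * g k := by
        gcongr
        · exact hg k
        · exact_mod_cast hfibre k

lemma sum_Icc_one_div_sqrt_le (m : ℕ) :
    ∑ k ∈ Finset.Icc 1 m, 1 / √(k : ℝ) ≤ 2 * √(m : ℝ) := by
  induction m with
  | zero => simp
  | succ m ih =>
    have hstep : 1 / √((m + 1 : ℕ) : ℝ) ≤ 2 * √((m + 1 : ℕ) : ℝ) - 2 * √(m : ℝ) := by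
      have hsucc : √((m + 1 : ℕ) : ℝ) ^ 2 = m + 1 := by
        rw [Real.sq_sqrt (by positivity)]; push_cast; ring
      have hm : √(m : ℝ) ^ 2 = m := Real.sq_sqrt (by positivity)
      rw [div_le_iff₀ (by positivity)]
      nlinarith [sq_nonneg (√((m + 1 : ℕ) : ℝ) - √(m : ℝ))]
    rw [Finset.sum_Icc_succ_top (by lia)]
    linarith

lemma sum_one_div_sqrt_abs_sub_le {X : Finset ℤ} {p : ℤ} {d : ℝ}
    (hX : ∀ q ∈ X, q ≠ p ∧ |(q : ℝ) - p| ≤ d) :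
    ∑ q ∈ X, 1 / √|(q : ℝ) - p| ≤ 4 * √d := by
  rcases X.eq_empty_or_nonempty with rfl | ⟨q, hq⟩
  · simp
  have hd : 0 ≤ d := (abs_nonneg _).trans (hX q hq).2
  have hnatAbs (q : ℤ) : |(q : ℝ) - p| = (q - p).natAbs := by
    rw [Nat.cast_natAbs]; push_cast; rfl
  have hmem : ∀ q ∈ X, (q - p).natAbs ∈ Finset.Icc 1 ⌊d⌋₊ := fun q hq => by
    obtain ⟨hne, hle⟩ := hX q hq
    rw [hnatAbs] at hle
    exact Finset.mem_Icc.2 ⟨by lia, Nat.le_floor hle⟩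
  simp_rw [hnatAbs]
  calc ∑ q ∈ X, 1 / √((q - p).natAbs : ℝ) ≤ 2 * ∑ k ∈ Finset.Icc 1 ⌊d⌋₊, 1 / √(k : ℝ) :=
        sum_natAbs_sub_le (g := fun k => 1 / √(k : ℝ)) (fun k => by positivity) hmem
    _ ≤ 2 * (2 * √(⌊d⌋₊ : ℝ)) := by gcongr; exact sum_Icc_one_div_sqrt_le _
    _ = 4 * √(⌊d⌋₊ : ℝ) := by ring
    _ ≤ 4 * √d := by gcongr; exact Nat.floor_le hd

end IntegerCounting

section Resonance

/-- `p` and `x - p` are admissible first frequencies of a point at scale `N` and a point at scale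
`n`, with implicit constant `c`, whose sum has first frequency `x`. -/
structure FreqBounds (c N n x p : ℝ) : Prop where
  fst_lower : N / c ≤ |p|
  fst_upper : |p| ≤ c * N
  snd_lower : n / c ≤ |x - p|
  snd_upper : |x - p| ≤ c * n

/-- The value near which the square of the transversality `η₁ / p - (η - η₁) / (x - p)` must lie for
`(p, η₁)` to be resonant with the output point `(τ, x, η)`; the parameter `k` is `ω(x, η) - τ`. -/
noncomputable def resonanceCenter (k x p : ℝ) : ℝ := k * x / (p * (x - p)) - 3 * x ^ 2

/- Since the unknown `k` enters only through `k * x`, it cancels when two of these identities are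
subtracted. -/
lemma resonanceCenter_mul {k x p : ℝ} (hp : p * (x - p) ≠ 0) :
    resonanceCenter k x p * (p * (x - p)) = k * x - 3 * x ^ 2 * (p * (x - p)) := by
  rw [resonanceCenter, sub_mul, div_mul_cancel₀ _ hp]

namespace FreqBounds

variable {c N n x p q : ℝ}

lemma abs_fst_sub_fst_le (hp : FreqBounds c N n x p) (hq : FreqBounds c N n x q) :
    |p - q| ≤ 2 * (c * n) := by
  calc |p - q| = |(x - q) - (x - p)| := by congr 1; ring
    _ ≤ |x - q| + |x - p| := abs_sub _ _
    _ ≤ 2 * (c * n) := by linarith [hp.snd_upper, hq.snd_upper]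

lemma abs_fst_mul_snd_le (hp : FreqBounds c N n x p) : |p * (x - p)| ≤ c ^ 2 * N * n := by
  calc |p * (x - p)| = |p| * |x - p| := abs_mul _ _
    _ ≤ c * N * (c * n) :=
        mul_le_mul hp.fst_upper hp.snd_upper (abs_nonneg _) ((abs_nonneg _).trans hp.fst_upper)
    _ = c ^ 2 * N * n := by ring

lemma fst_mul_snd_ne_zero (hp : FreqBounds c N n x p) (hc : 0 < c) (hN : 0 < N) (hn : 0 < n) :
    p * (x - p) ≠ 0 :=
  mul_ne_zero (abs_pos.1 ((by positivity : 0 < N / c).trans_le hp.fst_lower))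
    (abs_pos.1 ((by positivity : 0 < n / c).trans_le hp.snd_lower))

lemma le_abs_fst_sub_abs_snd (hp : FreqBounds c N n x p) (hq : FreqBounds c N n x q) (hc : 0 < c)
    (hnN : 2 * c ^ 2 * n ≤ N) : N / (2 * c) ≤ |p| - |x - q| := by
  have hsmall : c * n ≤ N / (2 * c) := by
    rw [le_div_iff₀ (by positivity)]; linarith
  have hhalf : N / c = 2 * (N / (2 * c)) := by field_simp
  linarith [hp.fst_lower, hq.snd_upper]

lemma abs_output_lower (hp : FreqBounds c N n x p) (hc : 0 < c) (hnN : 2 * c ^ 2 * n ≤ N) :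
    N / (2 * c) ≤ |x| :=
  (hp.le_abs_fst_sub_abs_snd hp hc hnN).trans <| by
    simpa [abs_sub_comm p x] using abs_sub_abs_le_abs_sub p (p - x)

lemma output_ne_zero (hp : FreqBounds c N n x p) (hc : 0 < c) (hn : 0 < n)
    (hnN : 2 * c ^ 2 * n ≤ N) : x ≠ 0 := by
  have hN : 0 < N := (by positivity : 0 < 2 * c ^ 2 * n).trans_le hnN
  exact abs_pos.1 ((by positivity : 0 < N / (2 * c)).trans_le (hp.abs_output_lower hc hnN))

lemma abs_fst_sub_snd_lower (hp : FreqBounds c N n x p) (hq : FreqBounds c N n x q) (hc : 0 < c)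
    (hnN : 2 * c ^ 2 * n ≤ N) : N / (2 * c) ≤ |p - (x - q)| :=
  (hp.le_abs_fst_sub_abs_snd hq hc hnN).trans (abs_sub_abs_le_abs_sub _ _)

lemma abs_ratio_lower (hp : FreqBounds c N n x p) (hc : 0 < c) (hn : 0 < n)
    (hnN : 2 * c ^ 2 * n ≤ N) : 1 / (2 * c ^ 3 * n) ≤ |x / (p * (x - p))| := by
  have hN : 0 < N := (by positivity : 0 < 2 * c ^ 2 * n).trans_le hnN
  have hmul : 0 < |p * (x - p)| := abs_pos.2 (hp.fst_mul_snd_ne_zero hc hN hn)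
  calc 1 / (2 * c ^ 3 * n) = N / (2 * c) / (c ^ 2 * N * n) := by field_simp
    _ ≤ |x| / |p * (x - p)| :=
        div_le_div₀ (abs_nonneg x) (hp.abs_output_lower hc hnN) hmul hp.abs_fst_mul_snd_le
    _ = |x / (p * (x - p))| := (abs_div _ _).symm

lemma le_abs_resonanceCenter_mul (hp : FreqBounds c N n x p) (hq : FreqBounds c N n x q)
    (hc : 0 < c) (hn : 0 < n) (hnN : 2 * c ^ 2 * n ≤ N) {k : ℝ}
    (hpq : |resonanceCenter k x p| ≤ |resonanceCenter k x q|) :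
    3 * (N / (2 * c)) ^ 2 * (|q - p| * (N / (2 * c))) ≤
      |resonanceCenter k x q| * (2 * (c ^ 2 * N * n)) := by
  have hN : 0 < N := (by positivity : 0 < 2 * c ^ 2 * n).trans_le hnN
  have hcancel : resonanceCenter k x q * (q * (x - q)) - resonanceCenter k x p * (p * (x - p)) =
      3 * x ^ 2 * ((q - p) * (q - (x - p))) := by
    rw [resonanceCenter_mul (hp.fst_mul_snd_ne_zero hc hN hn),
      resonanceCenter_mul (hq.fst_mul_snd_ne_zero hc hN hn)]
    ring
  calc 3 * (N / (2 * c)) ^ 2 * (|q - p| * (N / (2 * c)))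
      ≤ 3 * |x| ^ 2 * (|q - p| * |q - (x - p)|) := by
        gcongr
        · exact hp.abs_output_lower hc hnN
        · exact hq.abs_fst_sub_snd_lower hp hc hnN
    _ = |resonanceCenter k x q * (q * (x - q)) - resonanceCenter k x p * (p * (x - p))| := by
        rw [hcancel, abs_mul, abs_mul, abs_mul, abs_pow, Nat.abs_ofNat]
    _ ≤ |resonanceCenter k x q| * |q * (x - q)| + |resonanceCenter k x p| * |p * (x - p)| := by
        rw [← abs_mul, ← abs_mul]; exact abs_sub _ _
    _ ≤ |resonanceCenter k x q| * (c ^ 2 * N * n) + |resonanceCenter k x q| * (c ^ 2 * N * n) := by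
        gcongr
        · exact hq.abs_fst_mul_snd_le
        · exact hp.abs_fst_mul_snd_le
    _ = |resonanceCenter k x q| * (2 * (c ^ 2 * N * n)) := by ring

lemma le_abs_resonanceCenter (hp : FreqBounds c N n x p) (hq : FreqBounds c N n x q) (hc : 1 ≤ c)
    (hn : 0 < n) (hnN : 2 * c ^ 2 * n ≤ N) {k : ℝ}
    (hpq : |resonanceCenter k x p| ≤ |resonanceCenter k x q|) :
    (N / (3 * c ^ 3)) ^ 2 * (|q - p| / n) ≤ |resonanceCenter k x q| := by
  have hN : 0 < N := (by positivity : 0 < 2 * c ^ 2 * n).trans_le hnN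
  have hlower := hp.le_abs_resonanceCenter_mul hq (by positivity) hn hnN hpq
  refine le_of_mul_le_mul_right (hlower.trans' ?_) (by positivity : 0 < 2 * (c ^ 2 * N * n))
  calc (N / (3 * c ^ 3)) ^ 2 * (|q - p| / n) * (2 * (c ^ 2 * N * n))
      = 2 / 9 * N ^ 3 * |q - p| / c ^ 4 := by field_simp; ring
    _ ≤ 3 / 8 * N ^ 3 * |q - p| / c ^ 3 := by
        gcongr ?_ * _ * _ / ?_
        · norm_num
        · exact pow_le_pow_right₀ hc (by norm_num)
    _ = 3 * (N / (2 * c)) ^ 2 * (|q - p| * (N / (2 * c))) := by field_simp; ring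

end FreqBounds

lemma sub_omega_sub_omega_eq {ξ ξ₁ : ℤ} (hξ : (ξ : ℝ) ≠ 0) (h₁ : (ξ₁ : ℝ) ≠ 0)
    (h₂ : (ξ - ξ₁ : ℝ) ≠ 0) (τ : ℝ) (η η₁ : ℤ) :
    τ - omega ξ₁ η₁ - omega (ξ - ξ₁) (η - η₁) =
      ((ξ / (ξ₁ * (ξ - ξ₁)) * η₁ + -η / (ξ - ξ₁)) ^ 2 - resonanceCenter (omega ξ η - τ) ξ ξ₁) /
        (ξ / (ξ₁ * (ξ - ξ₁)) : ℝ) := by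
  simp only [omega, resonanceCenter]
  push_cast
  field_simp
  ring

/-- The pairs `(ξ₁, η₁)` with admissible `ξ₁` for which `τ` is within `M` of the sum of
the values of `ω` at `(ξ₁, η₁)` and `(ξ - ξ₁, η - η₁)`; `(τ, ξ, η)` is the output point. -/
def resonantSet (c N n M τ : ℝ) (ξ η : ℤ) : Set (ℤ × ℤ) :=
  {z | FreqBounds c N n ξ z.1 ∧ |τ - omega z.1 z.2 - omega (ξ - z.1) (η - z.2)| ≤ M}

variable {c N n M τ : ℝ} {ξ η p q : ℤ}

lemma fibre_resonantSet_subset (hc : 0 < c) (hn : 0 < n) (hnN : 2 * c ^ 2 * n ≤ N)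
    (hp : FreqBounds c N n ξ p) :
    Prod.mk p ⁻¹' resonantSet c N n M τ ξ η ⊆
      {η₁ : ℤ | |(ξ / (p * (ξ - p)) * η₁ + -η / (ξ - p) : ℝ) ^ 2 -
        resonanceCenter (omega ξ η - τ) ξ p| ≤ M * |(ξ / (p * (ξ - p)) : ℝ)|} := by
  rintro η₁ ⟨-, hres⟩
  have hN : 0 < N := (by positivity : 0 < 2 * c ^ 2 * n).trans_le hnN
  have hξ : (ξ : ℝ) ≠ 0 := hp.output_ne_zero hc hn hnN
  have hmul : (p * (ξ - p) : ℝ) ≠ 0 := hp.fst_mul_snd_ne_zero hc hN hn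
  rwa [sub_omega_sub_omega_eq hξ (left_ne_zero_of_mul hmul) (right_ne_zero_of_mul hmul), abs_div,
    div_le_iff₀ (abs_pos.2 (div_ne_zero hξ hmul))] at hres

lemma count_fibre_resonantSet_le (hc : 0 < c) (hn : 0 < n) (hnN : 2 * c ^ 2 * n ≤ N)
    (hM : 0 ≤ M) (hp : FreqBounds c N n ξ p) :
    count (Prod.mk p ⁻¹' resonantSet c N n M τ ξ η) ≤
      ENNReal.ofReal (2 + 4 * √(c ^ 3 * n * M)) := by
  set a : ℝ := ξ / (p * (ξ - p))
  have ha : 1 / (2 * c ^ 3 * n) ≤ |a| := hp.abs_ratio_lower hc hn hnN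
  have ha_pos : 0 < |a| := (by positivity : 0 < 1 / (2 * c ^ 3 * n)).trans_le ha
  refine (measure_mono (fibre_resonantSet_subset hc hn hnN hp)).trans <|
    (count_abs_sq_affine_sub_le_sqrt (abs_pos.1 ha_pos)).trans <| ENNReal.ofReal_le_ofReal ?_
  have hsqrt : √(2 * (M * |a|)) ≤ 2 * √(c ^ 3 * n * M) * |a| := by
    rw [div_le_iff₀ (by positivity)] at ha
    refine Real.sqrt_le_iff.2 ⟨by positivity, ?_⟩
    calc 2 * (M * |a|) ≤ 2 * (M * |a|) * (|a| * (2 * c ^ 3 * n)) :=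
          le_mul_of_one_le_right (by positivity) ha
      _ = (2 * √(c ^ 3 * n * M) * |a|) ^ 2 := by
        rw [mul_pow, mul_pow, Real.sq_sqrt (by positivity)]; ring
  linarith [(div_le_iff₀ ha_pos).2 hsqrt]

lemma count_fibre_resonantSet_le_div_sqrt (hc : 1 ≤ c) (hn : 0 < n) (hnN : 2 * c ^ 2 * n ≤ N)
    (hM : 0 ≤ M) (hp : FreqBounds c N n ξ p) (hq : FreqBounds c N n ξ q) (hqp : q ≠ p)
    (hpq : |resonanceCenter (omega ξ η - τ) ξ p| ≤ |resonanceCenter (omega ξ η - τ) ξ q|) :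
    count (Prod.mk q ⁻¹' resonantSet c N n M τ ξ η) ≤
      ENNReal.ofReal (2 + 12 * c ^ 3 * M * √n / N * (1 / √|(q : ℝ) - p|)) := by
  have hc0 : 0 < c := by positivity
  have hN : 0 < N := (by positivity : 0 < 2 * c ^ 2 * n).trans_le hnN
  have hgap : 0 < |(q : ℝ) - p| := abs_pos.2 (sub_ne_zero.2 (by exact_mod_cast hqp))
  have ha : (ξ / (q * (ξ - q)) : ℝ) ≠ 0 :=
    div_ne_zero (hq.output_ne_zero hc0 hn hnN) (hq.fst_mul_snd_ne_zero hc0 hN hn)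
  set A : ℝ := resonanceCenter (omega ξ η - τ) ξ q
  have hA : N / (3 * c ^ 3) * (√|(q : ℝ) - p| / √n) ≤ √|A| := by
    refine Real.le_sqrt_of_sq_le ?_
    rw [mul_pow, div_pow _ (√n), Real.sq_sqrt hn.le, Real.sq_sqrt hgap.le]
    exact hp.le_abs_resonanceCenter hq hc hn hnN hpq
  have hA_pos : 0 < √|A| := hA.trans_lt' (by positivity)
  refine (measure_mono (fibre_resonantSet_subset hc0 hn hnN hq)).trans <|
    (count_abs_sq_affine_sub_le_div_sqrt ha (abs_pos.1 (Real.sqrt_pos.1 hA_pos))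
      (by positivity)).trans <| ENNReal.ofReal_le_ofReal ?_
  calc 2 * (2 * (M * |(ξ / (q * (ξ - q)) : ℝ)|) / √|A| / |(ξ / (q * (ξ - q)) : ℝ)| + 1)
      = 2 + 4 * M / √|A| := by field_simp [abs_pos.2 ha]; ring
    _ ≤ 2 + 4 * M / (N / (3 * c ^ 3) * (√|(q : ℝ) - p| / √n)) := by gcongr
    _ = 2 + 12 * c ^ 3 * M * √n / N * (1 / √|(q : ℝ) - p|) := by field_simp; ring

lemma count_freqBounds_le (hc : 1 ≤ c) (hn : 1 ≤ n) :
    count {p : ℤ | FreqBounds c N n ξ p} ≤ ENNReal.ofReal (3 * (c * n)) := by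
  have hcn : 1 ≤ c * n := one_le_mul_of_one_le_of_one_le hc hn
  refine (count_le_of_forall_sub_le (d := 2 * (c * n)) (by positivity) fun p hp q hq =>
    (le_abs_self _).trans (hp.abs_fst_sub_fst_le hq)).trans (ENNReal.ofReal_le_ofReal ?_)
  linarith

lemma sum_fibre_bound_le {X : Finset ℤ} (hc : 1 ≤ c) (hn : 0 < n) (hN : 0 < N) (hM : 0 ≤ M)
    (hp : FreqBounds c N n ξ p) (hX : ∀ q ∈ X, FreqBounds c N n ξ q ∧ q ≠ p) :
    ∑ q ∈ X, (2 + 12 * c ^ 3 * M * √n / N * (1 / √|(q : ℝ) - p|)) ≤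
      2 * X.card + 72 * c ^ 4 * (n * M / N) := by
  have hsum : ∑ q ∈ X, 1 / √|(q : ℝ) - p| ≤ 4 * √(2 * (c * n)) :=
    sum_one_div_sqrt_abs_sub_le fun q hq => ⟨(hX q hq).2, (hX q hq).1.abs_fst_sub_fst_le hp⟩
  have hsqrt : √(2 * (c * n)) ≤ 3 / 2 * c * √n := by
    refine Real.sqrt_le_iff.2 ⟨by positivity, ?_⟩
    rw [mul_pow, Real.sq_sqrt hn.le]
    nlinarith [mul_pos (by positivity : 0 < c) hn]
  calc ∑ q ∈ X, (2 + 12 * c ^ 3 * M * √n / N * (1 / √|(q : ℝ) - p|))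
      = 2 * X.card + 12 * c ^ 3 * M * √n / N * ∑ q ∈ X, 1 / √|(q : ℝ) - p| := by
        rw [Finset.sum_add_distrib, Finset.sum_const, nsmul_eq_mul, mul_comm, Finset.mul_sum]
    _ ≤ 2 * X.card + 12 * c ^ 3 * M * √n / N * (4 * (3 / 2 * c * √n)) := by
        grw [hsum, hsqrt]
    _ = 2 * X.card + 72 * c ^ 4 * (√n ^ 2 * M / N) := by ring
    _ = 2 * X.card + 72 * c ^ 4 * (n * M / N) := by rw [Real.sq_sqrt hn.le]

lemma count_resonantSet_le_card {X : Finset ℤ} (hc : 1 ≤ c) (hn : 0 < n) (hnN : 2 * c ^ 2 * n ≤ N)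
    (hM : 0 ≤ M) (hX : ∀ p, p ∈ X ↔ FreqBounds c N n ξ p) :
    count (resonantSet c N n M τ ξ η) ≤
      ENNReal.ofReal (2 * X.card + 4 * √(c ^ 3 * n * M) + 72 * c ^ 4 * (n * M / N)) := by
  have hN : 0 < N := (by positivity : 0 < 2 * c ^ 2 * n).trans_le hnN
  have hcount := count_le_sum_fibre (S := resonantSet c N n M τ ξ η) fun z hz => (hX _).2 hz.1
  rcases X.eq_empty_or_nonempty with rfl | hX_ne
  · exact hcount.trans (by simp)
  obtain ⟨p, hpX, hmin⟩ := X.exists_min_image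
    (fun p : ℤ => |resonanceCenter (omega ξ η - τ) ξ p|) hX_ne
  have hp := (hX p).1 hpX
  have hrest : ∀ q ∈ X.erase p, FreqBounds c N n ξ q ∧ q ≠ p := fun q hq =>
    ⟨(hX q).1 (Finset.mem_of_mem_erase hq), Finset.ne_of_mem_erase hq⟩
  have hcard : ((X.erase p).card : ℝ) = X.card - 1 := Finset.cast_card_erase_of_mem hpX
  calc count (resonantSet c N n M τ ξ η)
      ≤ count (Prod.mk p ⁻¹' resonantSet c N n M τ ξ η) +
          ∑ q ∈ X.erase p, count (Prod.mk q ⁻¹' resonantSet c N n M τ ξ η) := by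
        rwa [Finset.add_sum_erase _ (fun q => count (Prod.mk q ⁻¹' _)) hpX]
    _ ≤ ENNReal.ofReal (2 + 4 * √(c ^ 3 * n * M)) + ∑ q ∈ X.erase p,
          ENNReal.ofReal (2 + 12 * c ^ 3 * M * √n / N * (1 / √|(q : ℝ) - p|)) :=
        add_le_add (count_fibre_resonantSet_le (by positivity) hn hnN hM hp) <|
          Finset.sum_le_sum fun q hq => count_fibre_resonantSet_le_div_sqrt hc hn hnN hM hp
            (hrest q hq).1 (hrest q hq).2 (hmin q (Finset.mem_of_mem_erase hq))
    _ ≤ ENNReal.ofReal (2 * X.card + 4 * √(c ^ 3 * n * M) + 72 * c ^ 4 * (n * M / N)) := by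
        rw [← ENNReal.ofReal_sum_of_nonneg fun q _ => by positivity,
          ← ENNReal.ofReal_add (by positivity) (Finset.sum_nonneg fun q _ => by positivity)]
        exact ENNReal.ofReal_le_ofReal (by linarith [sum_fibre_bound_le hc hn hN hM hp hrest])

lemma count_resonantSet_le (hc : 1 ≤ c) (hn : 1 ≤ n) (hnN : 2 * c ^ 2 * n ≤ N) (hM : 0 ≤ M) :
    count (resonantSet c N n M τ ξ η) ≤
      ENNReal.ofReal (72 * c ^ 4 * (n + √(n * M) + n * M / N)) := by
  have hcount := count_freqBounds_le (N := N) (ξ := ξ) hc hn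
  have hfin : {p : ℤ | FreqBounds c N n ξ p}.Finite :=
    count_apply_lt_top.1 (hcount.trans_lt ENNReal.ofReal_lt_top)
  have hcard : (hfin.toFinset.card : ℝ) ≤ 3 * (c * n) := by
    rw [count_apply_finite _ hfin, ← ENNReal.ofReal_natCast] at hcount
    exact (ENNReal.ofReal_le_ofReal_iff (by positivity)).1 hcount
  refine (count_resonantSet_le_card (X := hfin.toFinset) hc (by positivity) hnN hM
    fun p => hfin.mem_toFinset).trans (ENNReal.ofReal_le_ofReal ?_)
  have hlin : 6 * (c * n) ≤ 72 * c ^ 4 * n := by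
    have := mul_le_mul_of_nonneg_right (le_self_pow₀ hc four_ne_zero) (by positivity : 0 ≤ n)
    nlinarith [mul_nonneg (by positivity : 0 ≤ c ^ 4) (by positivity : 0 ≤ n)]
  have hsqrt : 4 * √(c ^ 3 * n * M) ≤ 72 * c ^ 4 * √(n * M) := by
    have : √(c ^ 3 * n * M) ≤ c ^ 4 * √(n * M) := by
      refine Real.sqrt_le_iff.2 ⟨by positivity, ?_⟩
      rw [mul_pow, Real.sq_sqrt (by positivity), mul_assoc, ← pow_mul]
      gcongr
      norm_num
    linarith [(by positivity : 0 ≤ c ^ 4 * √(n * M))]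
  linarith

end Resonance

section Bilinear

lemma IsDyadic.one_le {x : ℝ} (hx : IsDyadic x) : 1 ≤ x := by
  obtain ⟨k, rfl⟩ := hx
  exact one_le_pow₀ one_le_two

variable {c N₁ N₂ L₁ L₂ : ℝ} {f₁ f₂ : Freq → ℂ}

lemma LocalizedAt.volume_slice_le (h₁ : LocalizedAt c N₁ L₁ f₁) (y : ℤ × ℤ) :
    volume {t : ℝ | (t, y) ∈ support f₁} ≤ ENNReal.ofReal (2 * c * L₁) := by
  have hsub : {t : ℝ | (t, y) ∈ support f₁} ⊆ Metric.closedBall (omega y.1 y.2) (c * L₁) :=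
    fun t ht => (h₁ t y.1 y.2 ht).2
  exact (measure_mono hsub).trans_eq (by rw [Real.volume_closedBall, mul_assoc])

lemma volume_contributing_slice_le (hc : 0 ≤ c) (h₁ : LocalizedAt c N₁ L₁ f₁)
    (h₂ : LocalizedAt c N₂ L₂ f₂) (x : Freq) (y : ℤ × ℤ) :
    volume ((·, y) ⁻¹' (support f₁ ∩ (x - ·) ⁻¹' support f₂)) ≤
      ENNReal.ofReal (2 * c * min L₁ L₂) := by
  rw [mul_min_of_nonneg _ _ (by positivity), ENNReal.ofReal_min]
  refine le_min ((measure_mono fun t ht => ht.1).trans (h₁.volume_slice_le y)) ?_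
  calc volume ((·, y) ⁻¹' (support f₁ ∩ (x - ·) ⁻¹' support f₂))
      ≤ volume ((x.1 - ·) ⁻¹' {t : ℝ | (t, x.2 - y) ∈ support f₂}) := measure_mono fun t ht => ht.2
    _ = volume {t : ℝ | (t, x.2 - y) ∈ support f₂} :=
        (measurePreserving_sub_left volume x.1).measure_preimage_emb
          (MeasurableEquiv.subLeft x.1).measurableEmbedding _
    _ ≤ ENNReal.ofReal (2 * c * L₂) := h₂.volume_slice_le _

lemma image_snd_contributing_subset (hc : 0 ≤ c) (h₁ : LocalizedAt c N₁ L₁ f₁)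
    (h₂ : LocalizedAt c N₂ L₂ f₂) (τ : ℝ) (ξ η : ℤ) :
    Prod.snd '' (support f₁ ∩ (((τ, ξ, η) : Freq) - ·) ⁻¹' support f₂) ⊆
      resonantSet c N₁ N₂ (2 * c * max L₁ L₂) τ ξ η := by
  rintro _ ⟨⟨t, p, e⟩, ⟨hz₁, hz₂⟩, rfl⟩
  obtain ⟨⟨hp_lower, hp_upper⟩, hmod₁⟩ := h₁ t p e hz₁
  obtain ⟨⟨hs_lower, hs_upper⟩, hmod₂⟩ := h₂ (τ - t) (ξ - p) (η - e) hz₂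
  push_cast at hs_lower hs_upper
  refine ⟨⟨hp_lower, hp_upper, hs_lower, hs_upper⟩, ?_⟩
  calc |τ - omega p e - omega (ξ - p) (η - e)|
      = |(t - omega p e) + (τ - t - omega (ξ - p) (η - e))| := by congr 1; ring
    _ ≤ c * L₁ + c * L₂ := (abs_add_le _ _).trans (add_le_add hmod₁ hmod₂)
    _ ≤ c * max L₁ L₂ + c * max L₁ L₂ := by
        gcongr
        · exact le_max_left _ _
        · exact le_max_right _ _
    _ = 2 * c * max L₁ L₂ := by ring

lemma add_sqrt_add_div_le {α N n L : ℝ} (hα : α ≤ 1) (hN : 1 ≤ N) (hn : 0 ≤ n) (hL : N ^ α ≤ L) :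
    n + √(n * L) + n * L / N ≤
      2 * L * (n ^ (1 / 2 : ℝ) * N ^ (-α / 2) + n ^ (1 / 4 : ℝ) * N ^ (-α / 4)) ^ 2 := by
  have hN0 : 0 < N := by positivity
  have hL0 : 0 < L := (Real.rpow_pos_of_pos hN0 α).trans_le hL
  set u := n ^ (1 / 2 : ℝ) * N ^ (-α / 2)
  set v := n ^ (1 / 4 : ℝ) * N ^ (-α / 4)
  have hu : u ^ 2 = n * N ^ (-α) := by
    rw [mul_pow, ← Real.rpow_mul_natCast hn, ← Real.rpow_mul_natCast hN0.le]
    norm_num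
  have hv : (v ^ 2) ^ 2 = n * N ^ (-α) := by
    rw [← pow_mul, mul_pow, ← Real.rpow_mul_natCast hn, ← Real.rpow_mul_natCast hN0.le]
    norm_num
  have hone : 1 ≤ L * N ^ (-α) := by
    rw [Real.rpow_neg hN0.le, ← div_eq_mul_inv]
    exact (one_le_div (by positivity)).2 hL
  have hfirst : n ≤ L * u ^ 2 := by
    rw [hu, mul_left_comm]
    exact le_mul_of_one_le_right hn hone
  have hsecond : √(n * L) ≤ L * v ^ 2 := by
    refine Real.sqrt_le_iff.2 ⟨by positivity, ?_⟩
    rw [mul_pow, hv]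
    calc n * L ≤ n * L * (L * N ^ (-α)) := le_mul_of_one_le_right (by positivity) hone
      _ = L ^ 2 * (n * N ^ (-α)) := by ring
  have hthird : n * L / N ≤ L * u ^ 2 := by
    have hinv : N⁻¹ ≤ N ^ (-α) := by
      rw [← Real.rpow_neg_one]
      exact Real.rpow_le_rpow_of_exponent_le hN (by linarith)
    calc n * L / N = n * L * N⁻¹ := div_eq_mul_inv _ _
      _ ≤ n * L * N ^ (-α) := by gcongr
      _ = L * u ^ 2 := by rw [hu]; ring
  have huv : 0 ≤ L * (u * v) := by positivity
  nlinarith [mul_nonneg hL0.le (sq_nonneg v)]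

lemma freqMeasure_contributing_le {α : ℝ} (hc : 1 ≤ c) (hα : α ≤ 1) (hN₂ : 1 ≤ N₂)
    (hL₁ : 0 ≤ L₁) (hL₂ : 0 ≤ L₂) (hN : 2 * c ^ 2 * N₂ ≤ N₁) (hL : N₁ ^ α ≤ max L₁ L₂)
    (h₁ : LocalizedAt c N₁ L₁ f₁) (h₂ : LocalizedAt c N₂ L₂ f₂) (x : Freq) :
    freqMeasure (support f₁ ∩ (x - ·) ⁻¹' support f₂) ≤
      ENNReal.ofReal (24 * c ^ 3 *
        (N₂ ^ (1 / 2 : ℝ) * N₁ ^ (-α / 2) + N₂ ^ (1 / 4 : ℝ) * N₁ ^ (-α / 4)) *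
        (L₁ ^ (1 / 2 : ℝ) * L₂ ^ (1 / 2 : ℝ))) ^ 2 := by
  obtain ⟨τ, ξ, η⟩ := x
  set w := N₂ ^ (1 / 2 : ℝ) * N₁ ^ (-α / 2) + N₂ ^ (1 / 4 : ℝ) * N₁ ^ (-α / 4)
  set L := max L₁ L₂
  have hN₁ : 1 ≤ N₁ := by nlinarith [one_le_pow₀ hc (n := 2)]
  have hL0 : 0 ≤ L := le_max_of_le_left hL₁
  have hL₁₂ : (L₁ ^ (1 / 2 : ℝ) * L₂ ^ (1 / 2 : ℝ)) ^ 2 = L₁ * L₂ := by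
    rw [← Real.sqrt_eq_rpow, ← Real.sqrt_eq_rpow, mul_pow, Real.sq_sqrt hL₁, Real.sq_sqrt hL₂]
  have hscale : N₂ + √(N₂ * (2 * c * L)) + N₂ * (2 * c * L) / N₁ ≤ 2 * (2 * c * L) * w ^ 2 :=
    add_sqrt_add_div_le hα hN₁ (by positivity) (hL.trans (le_mul_of_one_le_left hL0 (by linarith)))
  calc freqMeasure (support f₁ ∩ (((τ, ξ, η) : Freq) - ·) ⁻¹' support f₂)
      ≤ count (Prod.snd '' (support f₁ ∩ (((τ, ξ, η) : Freq) - ·) ⁻¹' support f₂)) *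
          ENNReal.ofReal (2 * c * min L₁ L₂) := by
        rw [freqMeasure_eq_prod_count]
        exact prod_count_le_count_image_snd_mul
          (volume_contributing_slice_le (by positivity) h₁ h₂ _)
    _ ≤ ENNReal.ofReal (72 * c ^ 4 * (2 * (2 * c * L) * w ^ 2)) *
          ENNReal.ofReal (2 * c * min L₁ L₂) := by
        gcongr
        refine (measure_mono (image_snd_contributing_subset (by positivity) h₁ h₂ τ ξ η)).trans <|
          (count_resonantSet_le hc hN₂ hN (by positivity)).trans ?_
        gcongr
    _ = ENNReal.ofReal (24 * c ^ 3 * w * (L₁ ^ (1 / 2 : ℝ) * L₂ ^ (1 / 2 : ℝ))) ^ 2 := by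
        rw [← ENNReal.ofReal_mul (by positivity), ← ENNReal.ofReal_pow (by positivity)]
        congr 1
        rw [mul_pow _ (L₁ ^ (1 / 2 : ℝ) * _), hL₁₂, ← max_mul_min L₁ L₂]
        ring

end Bilinear

end KPII

open KPII in
theorem mainTheorem10_general {c α N₁ N₂ L₁ L₂ : ℝ} (hc : 1 ≤ c) (hα : α ≤ 1) (hN₂ : 1 ≤ N₂)
    (hL₁ : 0 ≤ L₁) (hL₂ : 0 ≤ L₂) (hN : 2 * c ^ 2 * N₂ ≤ N₁) (hL : N₁ ^ α ≤ max L₁ L₂)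
    {f₁ f₂ : Freq → ℂ} (hf₁ : MemLp f₁ 2 freqMeasure) (hf₂ : MemLp f₂ 2 freqMeasure)
    (h₁ : LocalizedAt c N₁ L₁ f₁) (h₂ : LocalizedAt c N₂ L₂ f₂) :
    ConvolutionExists f₁ f₂ (ContinuousLinearMap.mul ℂ ℂ) freqMeasure ∧
      MemLp (f₁ ⋆[ContinuousLinearMap.mul ℂ ℂ, freqMeasure] f₂) 2 freqMeasure ∧
      (eLpNorm (f₁ ⋆[ContinuousLinearMap.mul ℂ ℂ, freqMeasure] f₂) 2 freqMeasure).toReal ≤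
        24 * c ^ 3 *
          (N₂ ^ (1 / 2 : ℝ) * N₁ ^ (-α / 2) + N₂ ^ (1 / 4 : ℝ) * N₁ ^ (-α / 4)) *
          ((L₁ ^ (1 / 2 : ℝ) * (eLpNorm f₁ 2 freqMeasure).toReal) *
            (L₂ ^ (1 / 2 : ℝ) * (eLpNorm f₂ 2 freqMeasure).toReal)) := by
  have hB := freqMeasure_contributing_le hc hα hN₂ hL₁ hL₂ hN hL h₁ h₂
  refine ⟨convolutionExists_of_memLp_two _ hf₁ hf₂,
    memLp_two_convolution _ hf₁ hf₂ ENNReal.ofReal_ne_top hB, ?_⟩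
  have hN₁ : 0 ≤ N₁ := le_trans (by positivity) hN
  have hnorm := ENNReal.toReal_mono (by finiteness [hf₁.2, hf₂.2])
    (eLpNorm_two_convolution_le (ContinuousLinearMap.mul ℂ ℂ) hf₁.1 hf₂.1 hB)
  rw [ENNReal.toReal_mul, ENNReal.toReal_mul, ENNReal.toReal_mul, toReal_enorm,
    ContinuousLinearMap.opNorm_mul, one_mul, ENNReal.toReal_ofReal (by positivity)] at hnorm
  exact hnorm.trans_eq (by ring)

theorem mainTheorem10 :
    ∀ c : ℝ, 1 ≤ c → ∃ K : ℝ, 0 < K ∧ ∃ C : ℝ, 0 < C ∧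
      ∀ (α : ℝ), α ≤ 1 →
      ∀ (N₁ N₂ L₁ L₂ D : ℝ),
        KPII.IsDyadic N₁ → KPII.IsDyadic N₂ → KPII.IsDyadic L₁ → KPII.IsDyadic L₂ →
        2 ≤ D → K * N₂ ≤ N₁ →
        N₁ ^ α ≤ max L₁ L₂ → max L₁ L₂ ≤ c * (N₁ ^ 2 * N₂) →
      ∀ f₁ f₂ : KPII.Freq → ℂ,
        MeasureTheory.MemLp f₁ 2 KPII.freqMeasure →
        MeasureTheory.MemLp f₂ 2 KPII.freqMeasure →
        KPII.LocalizedAt c N₁ L₁ f₁ → KPII.LocalizedAt c N₂ L₂ f₂ →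
        KPII.TransversalityLE c D f₁ f₂ →
        MeasureTheory.ConvolutionExists f₁ f₂ (ContinuousLinearMap.mul ℂ ℂ) KPII.freqMeasure ∧
        MeasureTheory.MemLp
          (MeasureTheory.convolution f₁ f₂ (ContinuousLinearMap.mul ℂ ℂ) KPII.freqMeasure)
          2 KPII.freqMeasure ∧
        (MeasureTheory.eLpNorm
          (MeasureTheory.convolution f₁ f₂ (ContinuousLinearMap.mul ℂ ℂ) KPII.freqMeasure)
          2 KPII.freqMeasure).toReal ≤
          C * Real.log D *
            (N₂ ^ (1 / 2 : ℝ) * N₁ ^ (-α / 2) + N₂ ^ (1 / 4 : ℝ) * N₁ ^ (-α / 4)) *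
            ((L₁ ^ (1 / 2 : ℝ) * (MeasureTheory.eLpNorm f₁ 2 KPII.freqMeasure).toReal) *
              (L₂ ^ (1 / 2 : ℝ) * (MeasureTheory.eLpNorm f₂ 2 KPII.freqMeasure).toReal)) := by
  intro c hc
  have hlog2 : 0 < Real.log 2 := Real.log_pos one_lt_two
  refine ⟨2 * c ^ 2, by positivity, 24 * c ^ 3 / Real.log 2, by positivity, ?_⟩
  intro α hα N₁ N₂ L₁ L₂ D hN₁ hN₂ hL₁ hL₂ hD hN hL _ f₁ f₂ hf₁ hf₂ h₁ h₂ _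
  have hN₁0 : 0 ≤ N₁ := zero_le_one.trans hN₁.one_le
  have hN₂0 : 0 ≤ N₂ := zero_le_one.trans hN₂.one_le
  have hL₁0 : 0 ≤ L₁ := zero_le_one.trans hL₁.one_le
  have hL₂0 : 0 ≤ L₂ := zero_le_one.trans hL₂.one_le
  obtain ⟨hexists, hmem, hnorm⟩ :=
    mainTheorem10_general hc hα hN₂.one_le hL₁0 hL₂0 hN hL hf₁ hf₂ h₁ h₂
  refine ⟨hexists, hmem, hnorm.trans ?_⟩
  have hconst : 24 * c ^ 3 ≤ 24 * c ^ 3 / Real.log 2 * Real.log D := by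
    rw [div_mul_eq_mul_div, le_div_iff₀ hlog2]
    gcongr
  gcongr
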